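/- Let $\mathsf{Top}$ be the category of topological spaces and continuous maps, and let $\mathcal{C}$ be a full reflective subcategory of $\mathsf{Top}$, closed under isomorphisms (homeomorphisms). Suppose that every space in $\mathcal{C}$ is Hausdorff and that $\mathcal{C}$ contains a two-point discrete space. Call an object $X$ of $\mathcal{C}$ *finitely generated w.r.t. embeddings in $\mathcal{C}$* if its hom-functor $\mathcal{C}(X,-)$ preserves colimits (taken in $\mathcal{C}$) of directed diagrams in $\mathcal{C}$ (diagrams indexed by a poset in which every finite subset has an upper bound) all of whose connecting maps are embeddings, i.e. injective continuous maps whose domain carries the initial topology. Then the empty space is the only object of $\mathcal{C}$ that is finitely generated w.r.t. embeddings in $\mathcal{C}$: the empty space belongs to $\mathcal{C}$, and an object $X$ of $\mathcal{C}$ is finitely generated w.r.t. embeddings in $\mathcal{C}$ if and only if $X=\emptyset$. -/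

import Mathlib

open CategoryTheory CategoryTheory.Limits Opposite

universe u v w

/-- An object `X` is finitely generated with respect to a class `M` of morphisms if its hom-functor
`Hom(X, -)` preserves all colimits that exist of directed diagrams whose connecting morphisms lie in
`M`. A directed diagram is one indexed by a (small) poset in which every finite subset, the empty
one included, has an upper bound. -/
def IsFinitelyGeneratedWrt {C : Type w} [Category.{v} C] (M : MorphismProperty C) (X : C) : Prop :=
  ∀ (I : Type v) [PartialOrder I] [IsDirectedOrder I] [Nonempty I] (F : I ⥤ C),
    (∀ ⦃i j : I⦄ (f : i ⟶ j), M (F.map f)) → PreservesColimit F (coyoneda.obj (op X))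

/-- The class of embeddings (injective maps whose domain carries the initial topology) in the full
subcategory of `TopCat` given by `P`. -/
def embeddingsIn (P : ObjectProperty TopCat.{u}) : MorphismProperty P.FullSubcategory :=
  TopCat.isEmbedding.inverseImage P.ι

/-! Every Stone space `Y` lies in the subcategory: maps to `Bool` extend uniquely along the
reflection `η`, which gives a retraction of `η`, and the universal property makes it an inverse. It
remains to find a directed diagram of Stone spaces and embeddings whose colimit merges two points
that no stage merges; the constant maps from a nonempty `X` to these points then contradict
preservation. In the Arens pattern, leaves `(n, m)` tend to `mid n` and the points `mid n` tend to
`base`. The stage `(N, g)` realises only the columns `n ≤ N`; of each later column it keeps the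
leaves with `m ≤ g n` and sends them to `apex`. Each stage is a finite sum of convergent sequences,
but a Hausdorff target must identify `base` and `apex` (`apply_base_eq_apply_apex`). -/

/-- The reflection of a space, with its universal property stated for continuous maps. -/
theorem exists_reflection (P : ObjectProperty TopCat.{u}) [Reflective P.ι] (Y : TopCat.{u}) :
    ∃ (Z : TopCat.{u}) (_ : P Z) (η : C(Y, Z)), ∀ W : TopCat.{u}, P W → ∀ f : C(Y, W),
      ∃! g : C(Z, W), g.comp η = f := by
  let adj := reflectorAdjunction P.ι
  refine ⟨_, ((reflector P.ι).obj Y).property, (adj.unit.app Y).hom, fun W hW f => ?_⟩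
  let e := adj.homEquiv Y ⟨W, hW⟩
  refine ⟨(e.symm (TopCat.ofHom f)).hom.hom, ?_, fun g hg => ?_⟩
  · have h := e.apply_symm_apply (TopCat.ofHom f)
    rw [Adjunction.homEquiv_unit] at h
    exact congrArg TopCat.Hom.hom h
  · have h : e (ObjectProperty.homMk (TopCat.ofHom g)) = TopCat.ofHom f := by
      rw [Adjunction.homEquiv_unit]
      exact TopCat.hom_ext hg
    rw [← h, e.symm_apply_apply]
    rfl

/-! ### Stone spaces belong to the subcategory -/

/-- A two-point discrete space is homeomorphic to `Bool`. -/
theorem nonempty_homeomorph_bool {D : Type*} [TopologicalSpace D] [DiscreteTopology D]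
    (h : Nat.card D = 2) : Nonempty (D ≃ₜ Bool) := by
  have : Finite D := Nat.finite_of_card_ne_zero (by omega)
  have e : D ≃ Bool := (Finite.equivFinOfCardEq h).trans finTwoEquiv
  exact ⟨e.toHomeomorphOfDiscrete⟩

/-- A reflective subcategory of Hausdorff spaces that contains a two-point discrete space contains
all Stone spaces. -/
theorem prop_of_compact_totallySeparated (P : ObjectProperty TopCat.{u})
    [P.IsClosedUnderIsomorphisms] [Reflective P.ι]
    (hHaus : ∀ X : TopCat.{u}, P X → T2Space X)
    (hTwo : ∃ D : TopCat.{u}, P D ∧ DiscreteTopology D ∧ Nat.card D = 2)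
    (Y : TopCat.{u}) [CompactSpace Y] [TotallySeparatedSpace Y] : P Y := by
  obtain ⟨Z, hZ, η, hη⟩ := exists_reflection P Y
  have : T2Space Z := hHaus Z hZ
  have hB : ∀ f : C(Y, Bool), ∃! g : C(Z, Bool), g.comp η = f := by
    obtain ⟨D, hD, hdisc, hcard⟩ := hTwo
    obtain ⟨e⟩ := nonempty_homeomorph_bool hcard
    intro f
    obtain ⟨g, hg, hg'⟩ := hη D hD ((e.symm : C(Bool, D)).comp f)
    refine ⟨(e : C(D, Bool)).comp g, ?_, fun k hk => ?_⟩
    · ext y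
      have := congrArg (fun k : C(Y, D) => e (k y)) hg
      simpa using this
    · have := hg' ((e.symm : C(Bool, D)).comp k) (by
        show _ = _
        rw [← hk]; rfl)
      rw [← this]
      ext z
      simp
  choose χ hχ hχ' using hB
  have hχ_apply : ∀ f y, χ f (η y) = f y := fun f y => congrArg (fun k : C(Y, Bool) => k y) (hχ f)
  let e : Y → (C(Y, Bool) → Bool) := fun y f => f y
  let E : Z → (C(Y, Bool) → Bool) := fun z f => χ f z
  have he : Continuous e := continuous_pi fun f => f.continuous
  have hE : Continuous E := continuous_pi fun f => (χ f).continuous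
  have he_inj : Function.Injective e := by
    intro x y hxy
    by_contra hne
    obtain ⟨U, hU, hx, hy⟩ := exists_isClopen_of_totally_separated hne
    have := congrFun hxy ⟨_, (continuous_boolIndicator_iff_isClopen U).2 hU⟩
    have hy' : y ∉ U := hy
    simp [e, Set.boolIndicator, hx, hy'] at this
  have hcl : Topology.IsClosedEmbedding e := he.isClosedEmbedding he_inj
  -- A clopen set containing `E z` and missing the compact range of `e` would give a map `Z → Bool`
  -- that vanishes on the image of `η` but not at `z`, against uniqueness of extensions.
  have hrange : ∀ z, E z ∈ Set.range e := by
    intro z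
    by_contra hz
    obtain ⟨V, hV, hzV, hVr⟩ :=
      (TopologicalSpace.IsTopologicalBasis.exists_subset_of_mem_open
        (isTopologicalBasis_isClopen (X := C(Y, Bool) → Bool)) hz
        hcl.isClosed_range.isOpen_compl)
    have hVc : Continuous V.boolIndicator := (continuous_boolIndicator_iff_isClopen V).2 hV
    have h0 : (⟨_, hVc.comp hE⟩ : C(Z, Bool)) = ContinuousMap.const Z false := by
      rw [hχ' (ContinuousMap.const Y false) ⟨_, hVc.comp hE⟩,
        hχ' (ContinuousMap.const Y false) (ContinuousMap.const Z false)]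
      · rfl
      · ext y
        have h1 : E (η y) = e y := funext fun f => hχ_apply f y
        have h2 : e y ∉ V := fun h => hVr h ⟨y, rfl⟩
        simpa [h1, Set.boolIndicator] using h2
    have := congrArg (fun k : C(Z, Bool) => k z) h0
    simp [Set.boolIndicator, hzV] at this
  choose r hr using hrange
  have hrc : Continuous r := by
    rw [hcl.isEmbedding.continuous_iff]
    convert hE using 1
    exact funext hr
  have hrη : ∀ y, r (η y) = y := fun y =>
    he_inj ((hr _).trans (funext fun f => hχ_apply f y))
  have hηr : η.comp ⟨r, hrc⟩ = ContinuousMap.id Z := by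
    refine (hη Z hZ η).unique ?_ rfl
    ext y
    simp [hrη]
  refine P.prop_of_iso (TopCat.isoOfHomeo ?_) hZ
  exact { toFun := r, invFun := η, left_inv := fun z => congrArg (fun k : C(Z, Z) => k z) hηr,
          right_inv := hrη, continuous_toFun := hrc, continuous_invFun := η.continuous }

/-! ### Topologies given by a limit map -/

/-- The topology in which `x` is the limit of its fibre along the cofinite filter, for every `x`. -/
@[reducible]
def fibreTopology {T : Type*} (ρ : T → T) : TopologicalSpace T where
  IsOpen U := ∀ l ∈ U, {x | ρ x = l ∧ x ∉ U}.Finite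
  isOpen_univ := by simp
  isOpen_inter U V hU hV l hl := by
    refine ((hU l hl.1).union (hV l hl.2)).subset ?_
    rintro x ⟨hx, hxUV⟩
    by_cases h : x ∈ U
    · exact Or.inr ⟨hx, fun h' => hxUV ⟨h, h'⟩⟩
    · exact Or.inl ⟨hx, h⟩
  isOpen_sUnion S hS l := by
    rintro ⟨U, hU, hl⟩
    exact (hS U hU l hl).subset fun x hx => ⟨hx.1, fun h => hx.2 ⟨U, hU, h⟩⟩

/-- Cover members chosen around the finitely many values of `ρ` miss only finitely many points in
all. -/
theorem compactSpace_fibreTopology {T : Type*} (ρ : T → T) (hfin : (Set.range ρ).Finite) :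
    @CompactSpace T (fibreTopology ρ) := by
  let _ := fibreTopology ρ
  classical
  refine ⟨isCompact_of_finite_subcover fun {ι} U hU hcov => ?_⟩
  choose i hi using fun x : T => Set.mem_iUnion.1 (hcov (Set.mem_univ x))
  have hrest : (⋃ l ∈ Set.range ρ, {x | ρ x = l ∧ x ∉ U (i l)}).Finite :=
    hfin.biUnion fun l _ => hU (i l) l (hi l)
  refine ⟨hfin.toFinset.image i ∪ hrest.toFinset.image i, fun x _ => ?_⟩
  rw [Set.mem_iUnion₂]
  by_cases hx : x ∈ U (i (ρ x))
  · exact ⟨i (ρ x), by simp, hx⟩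
  · refine ⟨i x, Finset.mem_union_right _ (Finset.mem_image_of_mem _ ?_), hi x⟩
    rw [Set.Finite.mem_toFinset, Set.mem_iUnion₂]
    exact ⟨ρ x, ⟨x, rfl⟩, rfl, hx⟩

/-- Points not fixed by `ρ` are clopen, and so are the fibres, which separate the fixed points. -/
theorem totallySeparatedSpace_fibreTopology {T : Type*} (ρ : T → T) (hρ : ∀ x, ρ (ρ x) = ρ x) :
    @TotallySeparatedSpace T (fibreTopology ρ) := by
  let _ := fibreTopology ρ
  have hsingle : ∀ x, ρ x ≠ x → IsClopen ({x} : Set T) := by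
    intro x hx
    refine ⟨⟨?_⟩, ?_⟩
    · intro l _
      exact (Set.finite_singleton x).subset fun y hy => by simpa using hy.2
    · rintro l rfl
      refine Set.Finite.subset Set.finite_empty ?_
      rintro y ⟨hy, -⟩
      exact hx (by rw [← hy, hρ])
  have hfibre : ∀ l, IsClopen (ρ ⁻¹' {l}) := by
    intro l
    refine ⟨⟨?_⟩, ?_⟩
    · intro k hk
      refine Set.Finite.subset Set.finite_empty ?_
      rintro y ⟨hy, hy'⟩
      have : ρ y = l := by simpa using hy'
      exact hk (by simpa [← hy, hρ] using this)
    · intro k hk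
      refine Set.Finite.subset Set.finite_empty ?_
      rintro y ⟨hy, hy'⟩
      have hk : ρ k = l := hk
      exact hy' (by simp [← hk, ← hy, hρ])
  rw [totallySeparatedSpace_iff_exists_isClopen]
  intro x y hxy
  by_cases hx : ρ x = x
  · by_cases hy : ρ y = y
    · exact ⟨_, hfibre (ρ x), rfl, fun h => hxy (by
        have h : ρ y = ρ x := h
        rw [← hx, ← h, hy])⟩
    · exact ⟨_, (hsingle y hy).compl, hxy, by simp⟩
  · exact ⟨_, hsingle x hx, rfl, hxy.symm⟩

theorem continuous_fibreTopology {S T : Type*} {ρ : S → S} {σ : T → T} (f : S → T)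
    (hf : Function.Injective f) (h : {x | σ (f x) ≠ f (ρ x)}.Finite) :
    @Continuous S T (fibreTopology ρ) (fibreTopology σ) f := by
  let _ := fibreTopology ρ
  let _ := fibreTopology σ
  refine ⟨fun U hU l hl => ?_⟩
  refine (h.union ((hU (f l) hl).preimage hf.injOn)).subset ?_
  rintro x ⟨rfl, hx⟩
  by_cases hx' : σ (f x) = f (ρ x)
  · exact Or.inr ⟨hx', hx⟩
  · exact Or.inl hx'

/-- In the fibre topology, an injective sequence in the fibre of `l` converges to `l`. -/
theorem tendsto_fibreTopology {T : Type*} (ρ : T → T) (l : T) (s : ℕ → T)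
    (hs : Function.Injective s) (h : ∀ᶠ n in Filter.atTop, ρ (s n) = l) :
    Filter.Tendsto s Filter.atTop (@nhds T (fibreTopology ρ) l) := by
  let _ := fibreTopology ρ
  rw [tendsto_nhds]
  intro U hU hl
  have hfin : (s ⁻¹' {x | ρ x = l ∧ x ∉ U}).Finite := (hU l hl).preimage hs.injOn
  have := hfin.compl_mem_cofinite
  rw [Nat.cofinite_eq_atTop] at this
  filter_upwards [this, h] with n hn hn'
  by_contra hc
  exact hn ⟨hn', hc⟩

/-! ### The Arens diagram -/

/-- The points of the Arens space together with one further limit point. -/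
inductive ArensPoint
  | base
  | apex
  | mid (n : ℕ)
  | leaf (n m : ℕ)

namespace ArensPoint

/-- The limit to which a point of the stage `N` belongs. -/
def root (N : ℕ) : ArensPoint → ArensPoint
  | base => base
  | apex => apex
  | mid n => if n ≤ N then mid n else base
  | leaf n _ => if n ≤ N then mid n else apex

theorem root_root (N : ℕ) (x : ArensPoint) : root N (root N x) = root N x := by
  cases x <;> simp only [root] <;> (try split_ifs) <;> simp_all

theorem finite_range_root (N : ℕ) : (Set.range (root N)).Finite := by
  refine (((Set.finite_Iic N).image mid).union (Set.toFinite {base, apex})).subset ?_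
  rintro _ ⟨x, rfl⟩
  cases x <;> simp only [root] <;> (try split_ifs) <;> simp_all

/-- The points of the stage `(N, g)`. -/
def Mem (i : ℕ × (ℕ → ℕ)) : ArensPoint → Prop
  | leaf n m => n ≤ i.1 ∨ m ≤ i.2 n
  | _ => True

theorem Mem.mono {i j : ℕ × (ℕ → ℕ)} (h : i ≤ j) {x : ArensPoint} (hx : Mem i x) : Mem j x := by
  cases x with
  | leaf n m => exact hx.imp (fun h' => h'.trans h.1) fun h' => h'.trans (h.2 n)
  | _ => trivial

theorem mem_root (i : ℕ × (ℕ → ℕ)) (N : ℕ) (x : ArensPoint) : Mem i (root N x) := by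
  cases x <;> simp only [root] <;> (try split_ifs) <;> trivial

/-- Only the columns `i.1 < n ≤ j.1` change limit, and stage `i` holds finitely many leaves of each.
This finiteness makes the inclusions continuous. -/
theorem finite_root_ne {i j : ℕ × (ℕ → ℕ)} (h : i ≤ j) :
    {x | Mem i x ∧ root j.1 x ≠ root i.1 x}.Finite := by
  refine (((Set.finite_Iic j.1).image mid).union ((Set.finite_Iic j.1).biUnion fun n _ =>
    (Set.finite_Iic (i.2 n)).image (leaf n))).subset ?_
  rintro x ⟨hx, hne⟩
  have hle : i.1 ≤ j.1 := h.1
  rcases x with _ | _ | n | ⟨n, m⟩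
  · exact absurd rfl hne
  · exact absurd rfl hne
  · left
    refine ⟨n, ?_, rfl⟩
    by_contra hn
    have hn : ¬ n ≤ j.1 := hn
    exact hne (by simp [root, hn, show ¬ n ≤ i.1 by omega])
  · right
    have hn : n ≤ j.1 := by
      by_contra hn
      exact hne (by simp [root, hn, show ¬ n ≤ i.1 by omega])
    have hi : ¬ n ≤ i.1 := fun hi => hne (by simp [root, hn, hi])
    simp only [Set.mem_iUnion]
    exact ⟨n, hn, m, hx.resolve_left hi, rfl⟩

end ArensPoint

open ArensPoint

/-- The stage `(N, g)`: a finite sum of convergent sequences. -/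
def ArensStage (i : ULift.{u} (ℕ × (ℕ → ℕ))) : Type u := ULift.{u} {x : ArensPoint // Mem i.down x}

namespace ArensStage

/-- A point of a stage. -/
def mk (i : ULift.{u} (ℕ × (ℕ → ℕ))) (x : ArensPoint) (hx : Mem i.down x) : ArensStage i :=
  ⟨⟨x, hx⟩⟩

theorem mk_injective {i : ULift.{u} (ℕ × (ℕ → ℕ))} {x y : ArensPoint} {hx : Mem i.down x}
    {hy : Mem i.down y} (h : mk i x hx = mk i y hy) : x = y :=
  congrArg (fun z : ArensStage i => z.down.1) h

/-- The limit to which a point belongs. -/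
def root (i : ULift.{u} (ℕ × (ℕ → ℕ))) (x : ArensStage i) : ArensStage i :=
  mk i (ArensPoint.root i.down.1 x.down.1) (mem_root _ _ _)

instance (i : ULift.{u} (ℕ × (ℕ → ℕ))) : TopologicalSpace (ArensStage i) := fibreTopology (root i)

instance (i : ULift.{u} (ℕ × (ℕ → ℕ))) : CompactSpace (ArensStage i) := by
  refine compactSpace_fibreTopology _ ?_
  have hinj : Function.Injective fun x : ArensStage i => x.down.1 :=
    fun x y h => ULift.ext _ _ (Subtype.ext h)
  refine ((finite_range_root i.down.1).preimage hinj.injOn).subset ?_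
  rintro _ ⟨x, rfl⟩
  exact ⟨x.down.1, rfl⟩

instance (i : ULift.{u} (ℕ × (ℕ → ℕ))) : TotallySeparatedSpace (ArensStage i) :=
  totallySeparatedSpace_fibreTopology _ fun x =>
    ULift.ext _ _ (Subtype.ext (root_root i.down.1 x.down.1))

/-- The inclusion of a stage in a later one. -/
def incl {i j : ULift.{u} (ℕ × (ℕ → ℕ))} (h : i ≤ j) (x : ArensStage i) : ArensStage j :=
  mk j x.down.1 (x.down.2.mono h)

theorem incl_injective {i j : ULift.{u} (ℕ × (ℕ → ℕ))} (h : i ≤ j) :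
    Function.Injective (incl h) :=
  fun _ _ hxy => ULift.ext _ _ (Subtype.ext (mk_injective hxy))

theorem continuous_incl {i j : ULift.{u} (ℕ × (ℕ → ℕ))} (h : i ≤ j) : Continuous (incl h) := by
  refine continuous_fibreTopology _ (incl_injective h) ?_
  have hinj : Function.Injective fun x : ArensStage i => x.down.1 :=
    fun x y h => ULift.ext _ _ (Subtype.ext h)
  refine ((finite_root_ne (i := i.down) (j := j.down) h).preimage hinj.injOn).subset ?_
  intro x hx
  exact ⟨x.down.2, fun h' => hx (ULift.ext _ _ (Subtype.ext h'))⟩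

theorem isEmbedding_incl {i j : ULift.{u} (ℕ × (ℕ → ℕ))} (h : i ≤ j) :
    Topology.IsEmbedding (incl h) :=
  ((continuous_incl h).isClosedEmbedding (incl_injective h)).isEmbedding

/-- Compatible continuous maps from the stages to a Hausdorff space identify the two limits. -/
theorem apply_base_eq_apply_apex {H : Type*} [TopologicalSpace H] [T2Space H]
    (f : ∀ i : ULift.{u} (ℕ × (ℕ → ℕ)), ArensStage i → H) (hf : ∀ i, Continuous (f i))
    (hcomp : ∀ (i j) (h : i ≤ j) (x), f j (incl h x) = f i x) (i : ULift.{u} (ℕ × (ℕ → ℕ))) :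
    f i (mk i base trivial) = f i (mk i apex trivial) := by
  have heq : ∀ (i j : ULift.{u} (ℕ × (ℕ → ℕ))) (x) (hi : Mem i.down x) (hj : Mem j.down x),
      f i (mk i x hi) = f j (mk j x hj) := by
    intro i j x hi hj
    rw [← hcomp i (i ⊔ j) le_sup_left, ← hcomp j (i ⊔ j) le_sup_right]
    rfl
  by_contra hne
  obtain ⟨U, V, hU, hV, hbU, haV, hdisj⟩ := t2_separation hne
  have hmid : ∀ᶠ n in Filter.atTop, f i (mk i (mid n) trivial) ∈ U := by
    have ht := tendsto_fibreTopology (root i) (mk i base trivial) (fun n => mk i (mid n) trivial)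
      (fun a b h => by simpa using mk_injective h)
      (by
        filter_upwards [Filter.eventually_gt_atTop i.down.1] with n hn
        refine ULift.ext _ _ (Subtype.ext ?_)
        simp [root, mk, ArensPoint.root, hn])
    exact ((hf i).continuousAt.tendsto.comp ht).eventually (hU.mem_nhds hbU)
  have hleaf : ∀ n, ∃ m, f i (mk i (mid n) trivial) ∈ U →
      f ⟨(n, 0)⟩ (mk ⟨(n, 0)⟩ (leaf n m) (Or.inl le_rfl)) ∈ U := by
    intro n
    by_cases hn : f i (mk i (mid n) trivial) ∈ U
    -- Stage `(n, 0)` contains the whole column `n`, with limit `mid n`.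
    · have ht := tendsto_fibreTopology (root ⟨(n, 0)⟩) (mk ⟨(n, 0)⟩ (mid n) trivial)
        (fun m => mk ⟨(n, 0)⟩ (leaf n m) (Or.inl le_rfl))
        (fun a b h => by simpa using mk_injective h)
        (Filter.Eventually.of_forall fun m => by
          refine ULift.ext _ _ (Subtype.ext ?_)
          simp [root, mk, ArensPoint.root])
      rw [heq i ⟨(n, 0)⟩ (mid n) trivial trivial] at hn
      obtain ⟨m, hm⟩ := (((hf _).continuousAt.tendsto.comp ht).eventually (hU.mem_nhds hn)).exists
      exact ⟨m, fun _ => hm⟩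
    · exact ⟨0, fun h => absurd h hn⟩
  -- The diagonal step: this `g`, chosen from `U`, is itself an index, and in stage `(0, g)` the
  -- leaves `(n, g n)` with `n > 0` tend to `apex`, hence enter `V`.
  choose g hg using hleaf
  have hapex : ∀ᶠ n in Filter.atTop,
      f ⟨(0, g)⟩ (mk ⟨(0, g)⟩ (leaf n (g n)) (Or.inr le_rfl)) ∈ V := by
    have ht := tendsto_fibreTopology (root ⟨(0, g)⟩) (mk ⟨(0, g)⟩ apex trivial)
      (fun n => mk ⟨(0, g)⟩ (leaf n (g n)) (Or.inr le_rfl))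
      (fun a b h => by
        have := mk_injective h
        simp only [leaf.injEq] at this
        exact this.1)
      (by
        filter_upwards [Filter.eventually_gt_atTop 0] with n hn
        refine ULift.ext _ _ (Subtype.ext ?_)
        simp [root, mk, ArensPoint.root, hn.ne'])
    rw [heq i ⟨(0, g)⟩ apex trivial trivial] at haV
    exact ((hf _).continuousAt.tendsto.comp ht).eventually (hV.mem_nhds haV)
  obtain ⟨n, hn, hn'⟩ := (hmid.and hapex).exists
  refine Set.disjoint_left.1 hdisj (hg n hn) ?_
  exact (heq ⟨(n, 0)⟩ ⟨(0, g)⟩ (leaf n (g n)) (Or.inl le_rfl) (Or.inr le_rfl)).symm ▸ hn'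

end ArensStage

/-- The directed diagram of the stages. -/
def arensDiagram (P : ObjectProperty TopCat.{u})
    (hP : ∀ i, P (TopCat.of (ArensStage.{u} i))) :
    ULift.{u} (ℕ × (ℕ → ℕ)) ⥤ P.FullSubcategory where
  obj i := ⟨TopCat.of (ArensStage i), hP i⟩
  map f := ObjectProperty.homMk (TopCat.ofHom ⟨_, ArensStage.continuous_incl (leOfHom f)⟩)
  map_id _ := rfl
  map_comp _ _ := rfl

/-! ### The two implications -/

/-- The hom-functor of an empty space preserves colimits of directed diagrams. -/
theorem isFinitelyGeneratedWrt_of_isEmpty (P : ObjectProperty TopCat.{u})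
    (M : MorphismProperty P.FullSubcategory) (X : P.FullSubcategory) [IsEmpty X.obj] :
    IsFinitelyGeneratedWrt M X := by
  intro I _ _ _ F _
  have hsub : ∀ {Z : P.FullSubcategory} (f g : X ⟶ Z), f = g := fun f g =>
    ObjectProperty.hom_ext _ (TopCat.hom_ext (ContinuousMap.ext fun x => isEmptyElim x))
  have hne : ∀ Z : P.FullSubcategory, Nonempty (X ⟶ Z) := fun Z =>
    ⟨ObjectProperty.homMk (TopCat.ofHom ⟨isEmptyElim, continuous_of_discreteTopology⟩)⟩
  let e : ∀ Z : P.FullSubcategory, X ⟶ Z := fun Z => (hne Z).some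
  let i₀ : I := Classical.arbitrary I
  -- All hom-sets out of `X` are singletons and the index poset is nonempty and directed, so a
  -- cocone is determined by its value at `i₀`.
  refine ⟨fun {c} _ => ⟨{
    desc := fun s => TypeCat.ofHom fun _ => s.ι.app i₀ (e (F.obj i₀))
    fac := fun s j => ?_
    uniq := fun s m hm => ?_ }⟩⟩
  · ext x
    obtain ⟨k, hk₀, hkj⟩ := exists_ge_ge i₀ j
    have h₀ := ConcreteCategory.congr_hom (s.w (homOfLE hk₀)) (e (F.obj i₀))
    have hj := ConcreteCategory.congr_hom (s.w (homOfLE hkj)) x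
    refine (h₀.symm.trans ?_).trans hj
    exact congrArg (s.ι.app k) (hsub _ _)
  · ext x
    have h := ConcreteCategory.congr_hom (hm i₀) (e (F.obj i₀))
    refine Eq.trans ?_ h
    exact congrArg m (hsub _ _)

theorem isEmpty_of_isFinitelyGeneratedWrt (P : ObjectProperty TopCat.{u}) [Reflective P.ι]
    (hHaus : ∀ X : TopCat.{u}, P X → T2Space X)
    (hP : ∀ i, P (TopCat.of (ArensStage.{u} i))) (X : P.FullSubcategory)
    (hX : IsFinitelyGeneratedWrt (embeddingsIn P) X) : IsEmpty X.obj := by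
  refine ⟨fun x => ?_⟩
  let F := arensDiagram P hP
  have hpres : PreservesColimit F (coyoneda.obj (op X)) :=
    hX _ F fun i j f => ArensStage.isEmbedding_incl (leOfHom f)
  have : HasColimitsOfShape (ULift.{u} (ℕ × (ℕ → ℕ))) P.FullSubcategory :=
    hasColimitsOfShape_of_reflective P.ι
  let c := colimit.cocone F
  have hc := isColimitOfPreserves (coyoneda.obj (op X)) (colimit.isColimit F)
  have : T2Space c.pt.obj := hHaus _ c.pt.property
  let i : ULift.{u} (ℕ × (ℕ → ℕ)) := ⟨(0, 0)⟩
  let k : ArensStage i → (X ⟶ F.obj i) := fun y =>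
    ObjectProperty.homMk (TopCat.ofHom (ContinuousMap.const X.obj y))
  let f : ∀ j, C(ArensStage j, c.pt.obj) := fun j => (c.ι.app j).hom.hom
  have heq : f i (ArensStage.mk i base trivial) = f i (ArensStage.mk i apex trivial) :=
    ArensStage.apply_base_eq_apply_apex (fun j => f j) (fun j => (f j).continuous)
      (fun a b h y => congrArg (fun m : F.obj a ⟶ c.pt => m.hom y) (c.w (homOfLE h))) i
  have hk : k (ArensStage.mk i base trivial) ≫ c.ι.app i =
      k (ArensStage.mk i apex trivial) ≫ c.ι.app i :=
    ObjectProperty.hom_ext _ (TopCat.hom_ext (ContinuousMap.ext fun _ => heq))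
  -- Elements equal in a filtered colimit of sets already agree at some stage `j`.
  obtain ⟨j, f, hf⟩ := (Types.FilteredColimit.isColimit_eq_iff' hc
    (k (ArensStage.mk i base trivial)) (k (ArensStage.mk i apex trivial))).1 hk
  have hfx : ArensStage.incl (leOfHom f) (ArensStage.mk i base trivial) =
      ArensStage.incl (leOfHom f) (ArensStage.mk i apex trivial) :=
    congrArg (fun m : X ⟶ F.obj j => m.hom x) hf
  exact ArensPoint.noConfusion (ArensStage.mk_injective (ArensStage.incl_injective _ hfx))

theorem mainTheorem10 (P : ObjectProperty TopCat.{u}) [P.IsClosedUnderIsomorphisms]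
    [Reflective P.ι]
    (hHaus : ∀ X : TopCat.{u}, P X → T2Space X)
    (hTwo : ∃ D : TopCat.{u}, P D ∧ DiscreteTopology D ∧ Nat.card D = 2) :
    P (TopCat.of PEmpty.{u + 1}) ∧
      ∀ X : P.FullSubcategory,
        IsFinitelyGeneratedWrt (embeddingsIn P) X ↔ IsEmpty X.obj := by
  have hStone : ∀ (Y : Type u) [TopologicalSpace Y] [CompactSpace Y] [TotallySeparatedSpace Y],
      P (TopCat.of Y) := fun Y => prop_of_compact_totallySeparated P hHaus hTwo (TopCat.of Y)
  exact ⟨hStone _, fun X =>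
    ⟨isEmpty_of_isFinitelyGeneratedWrt P hHaus (fun _ => hStone _) X,
      fun _ => isFinitelyGeneratedWrt_of_isEmpty P _ X⟩⟩
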